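/- Let $\mathcal X_U,\mathcal X_I,\mathcal Z$ be measurable spaces (user features, item features, latent features), $\mathcal X=\mathcal X_U\times\mathcal X_I$, and let $\phi:\mathcal X\to\mathcal Z$ be a measurable feature map. Let $P$ (training) and $Q$ (testing) be probability measures on $\mathcal X$, and let $P_z=\phi_*P$, $Q_z=\phi_*Q$ be the induced distributions on $\mathcal Z$. Let $k,g:\mathcal X\to[0,1]$ be measurable labeling functions: a label $R\in\{0,1\}$ equals $1$ with conditional probability $k(x)$ in the training distribution and $g(x)$ in the testing distribution. For $f:\mathcal X\to\{0,1\}$ let $\mathcal L_Q(f)=\mathbb E_{x\sim Q}\,|f(x)-g(x)|$, which is the probability that $f(x)$ disagrees with the label when $x\sim Q$ and the label is $1$ with probability $g(x)$ (the 0-1 risk). Let $\tilde k,\tilde g:\mathcal Z\to[0,1]$ be measurable versions of the induced latent labeling functions $\tilde k(z)=\mathbb E_P[k(x)\mid\phi(x)=z]$ and $\tilde g(z)=\mathbb E_Q[g(x)\mid\phi(x)=z]$. Let $\mathcal H$ be a class of measurable functions $\mathcal Z\to\{0,1\}$ of VC-dimension $d<\infty$, such that for every $n$ and every $b\in\{0,1\}^n$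 the set $\{z\in\mathcal Z^n:\exists h\in\mathcal H,\ h(z_i)=b_i\ \forall i\}$ is measurable up to a null set for $P_z^{\otimes n}$ and for $Q_z^{\otimes n}$. Let $\rho\in[0,1]$ and $\delta>0$, and let $N,M$ be sample sizes such that $N\ge1$ and $d\le 2N$ if $\rho>0$, and $M\ge1$ and $d\le2M$ if $\rho<1$. Let $\mathcal D_P$ be $N$ i.i.d. labeled examples $(x,y)$ with $x\sim P$ and $y=1$ with conditional probability $k(x)$, and let $\mathcal D_Q$ be $M$ i.i.d. labeled examples $(x,y)$ with $x\sim Q$ and $y=1$ with conditional probability $g(x)$. Let $\widehat{\mathcal L}_P(f)$ and $\widehat{\mathcal L}_Q(f)$ be the averages of the 0-1 loss $\mathbf 1[f(x)\ne y]$ over $\mathcal D_P$ and $\mathcal D_Q$. Then with probability at least $1-\delta$ over the samples (that is, on a measurable event of at least this probability), for all $h\in\mathcal H$ simultaneously, $$\begin{aligned}\mathcal L_Q(h\circ\phi)\le{}&\rho\,\widehat{\mathcal L}_P(h\circ\phi)+(1-\rho)\,\widehat{\mathcal L}_Q(h\circ\phi)+\frac{\rho}{2}\sqrt{2\,\mathrm{KL}(P_z\,\|\,Q_z)}\\&+\rho\min\bigl\{\mathbb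 E_{P_z}|\tilde g(z)-\tilde k(z)|,\ \mathbb E_{Q_z}|\tilde g(z)-\tilde k(z)|\bigr\}\\&+(1-\rho)\sqrt{\tfrac4M\bigl(d\log\tfrac{2eM}{d}+\log\tfrac4\delta\bigr)}+\rho\sqrt{\tfrac4N\bigl(d\log\tfrac{2eN}{d}+\log\tfrac4\delta\bigr)}.\end{aligned}$$ Here $e$ is Euler's number, $d\log\frac{2en}{d}$ means $0$ for $d=0$, $\mathrm{KL}$ may be $+\infty$, $0\cdot\infty=0$, and a term with coefficient $0$ is omitted. -/

import Mathlib

open MeasureTheory ProbabilityTheory InformationTheory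

open scoped unitInterval ENNReal

namespace UnbiasedRec

noncomputable section

/-- The 0-1 loss between a predicted and an observed binary label. -/
def zeroOneLoss (a b : Bool) : ℝ := if a = b then 0 else 1

/-- The 0-1 loss of the prediction `a` against a labeling value `p = p(R = 1 | ·)`: the probability
that a label which is `1` with probability `p` and `0` with probability `1 - p` disagrees
with `a`. For a deterministic labeling value (`p = 0` or `p = 1`) it is the usual 0-1 loss. -/
def labelLoss (a : Bool) (p : I) : ℝ :=
  p * zeroOneLoss a true + (1 - p) * zeroOneLoss a false

/-- With labels read as the numbers `0` and `1`, the loss is the absolute difference. -/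
theorem labelLoss_eq_abs (a : Bool) (p : I) :
    labelLoss a p = |(if a then 1 else 0 : ℝ) - p| := by
  have h0 : (0 : ℝ) ≤ p := p.2.1
  have h1 : (p : ℝ) ≤ 1 := p.2.2
  cases a
  · simp [labelLoss, zeroOneLoss, abs_of_nonneg h0]
  · simp [labelLoss, zeroOneLoss, abs_of_nonneg (sub_nonneg.2 h1)]

/-- The risk of the classifier `f` when the features have law `μ` and the labeling function
is `g`. -/
def risk {X : Type*} [MeasurableSpace X] (μ : Measure X) (f : X → Bool) (g : X → I) : ℝ :=
  ∫ x, labelLoss (f x) (g x) ∂μ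

/-- The law of a labeled example `(x, y)`: the feature `x` has law `μ` and, given `x`, the label
`y` equals `1` with probability `g x` and `0` with probability `1 - g x`. -/
def sampleLaw {X : Type*} [MeasurableSpace X] (μ : Measure X) (g : X → I) :
    Measure (X × Bool) :=
  (μ.withDensity fun x => ENNReal.ofReal (g x)).map (fun x => (x, true)) +
    (μ.withDensity fun x => ENNReal.ofReal (1 - g x)).map (fun x => (x, false))

/-- The empirical risk: the average 0-1 loss over a labeled sample of size `n`. -/
def empiricalRisk {X : Type*} {n : ℕ} (f : X → Bool) (s : Fin n → X × Bool) : ℝ :=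
  (1 / (n : ℝ)) * ∑ i, zeroOneLoss (f (s i).1) (s i).2

/-- The class `H` shatters the finite set `s`: every 0-1 labeling of `s` is realized in `H`. -/
def Shatters {Z : Type*} (H : Set (Z → Bool)) (s : Finset Z) : Prop :=
  ∀ b : Z → Bool, ∃ h ∈ H, ∀ z ∈ s, h z = b z

/-- The VC-dimension: the supremum of the cardinalities of the shattered finite sets. -/
def vcDim {Z : Type*} (H : Set (Z → Bool)) : ℕ∞ :=
  ⨆ (s : Finset Z) (_ : Shatters H s), (s.card : ℕ∞)

/-- `g'` is (a version of) the latent labeling function induced by `g` and the feature map `φ`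
under the feature law `μ`, that is, the conditional mean `g' z = E_μ[g(x) | φ(x) = z]`. -/
structure IsInducedLabeling {X Z : Type*} [MeasurableSpace X] [MeasurableSpace Z]
    (μ : Measure X) (φ : X → Z) (g : X → I) (g' : Z → I) : Prop where
  measurable : Measurable g'
  setIntegral_eq : ∀ B : Set Z, MeasurableSet B →
    ∫ x in φ ⁻¹' B, (g x : ℝ) ∂μ = ∫ z in B, (g' z : ℝ) ∂(μ.map φ)

/-- Measurability of the class `H` for samples from `μ`: for every `n` and every 0-1 pattern `b`
of length `n`, the set of those `n`-point samples on which some member of `H` realizes `b`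
is measurable up to a null set. -/
def HasMeasurableTraces {Z : Type*} [MeasurableSpace Z] (H : Set (Z → Bool))
    (μ : Measure Z) : Prop :=
  ∀ (n : ℕ) (b : Fin n → Bool),
    NullMeasurableSet {z : Fin n → Z | ∃ h ∈ H, ∀ i, h (z i) = b i} (Measure.pi fun _ => μ)

/-- The complexity term `√((4/n) (d log(2en/d) + log(4/δ)))`; for `d = 0` the summand
`d log(2en/d)` is `0`. -/
def complexityTerm (n d : ℕ) (δ : ℝ) : ℝ :=
  √((4 / (n : ℝ)) * (d * Real.log (2 * Real.exp 1 * n / d) + Real.log (4 / δ)))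

end

end UnbiasedRec

namespace UnbiasedRec

/-! Write the testing risk as `ρ` times itself plus `1 - ρ` times itself. The second share is
estimated by a VC bound on the testing sample. In the first share the testing domain is exchanged
for the training domain, and then a VC bound on the training sample applies.

The exchange takes place on `Z`. For a fixed prediction the loss is affine in the labeling value, so
the risk of `h ∘ φ` sees the labeling function only through its conditional mean given `φ`
(`risk_comp_eq_risk_map`). Changing the labeling function costs the mean of `|g' - k'|` under the
current law. Changing the law costs a Pinsker term. The two orders of these changes give the two
entries of the minimum.

The VC bound `measure_exists_deviation_le` avoids a supremum over `H`, which need not be measurable.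
Jensen's inequality over an independent ghost sample bounds the exponential of the deviation of any
member of `H` by the mean of `patternSum`, a finite sum over the 0-1 patterns realized on the double
sample. Exchanging points within pairs preserves the product law and turns each pattern's deviation
into a Rademacher sum. Sauer-Shelah counts the patterns, and Markov's inequality concludes. -/

/-! ### Counting patterns: Sauer-Shelah -/

/-- The growth of the number of small subsets: `∑_{k ≤ d} C(m, k) ≤ (em/d)^d`. -/
theorem sum_choose_le_exp_mul_div_pow {m d : ℕ} (hd : 0 < d) (hdm : d ≤ m) :
    (∑ j ∈ Finset.range (d + 1), (m.choose j : ℝ)) ≤ (Real.exp 1 * m / d) ^ d := by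
  have hd' : (0 : ℝ) < d := by exact_mod_cast hd
  have hm' : (0 : ℝ) < m := by exact_mod_cast hd.trans_le hdm
  have hq0 : (0 : ℝ) < d / m := by positivity
  have hq1 : (d : ℝ) / m ≤ 1 := by
    rw [div_le_one hm']; exact_mod_cast hdm
  -- As `d / m ≤ 1`, the weight `(d / m) ^ d` is at most `(d / m) ^ j` for `j ≤ d`. The weighted sum
  -- is then part of the binomial expansion of `(1 + d / m) ^ m`, which is at most `exp d`.
  have key : (∑ j ∈ Finset.range (d + 1), (m.choose j : ℝ)) * (d / m : ℝ) ^ d ≤ Real.exp 1 ^ d := by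
    calc (∑ j ∈ Finset.range (d + 1), (m.choose j : ℝ)) * (d / m : ℝ) ^ d
        ≤ ∑ j ∈ Finset.range (d + 1), (d / m : ℝ) ^ j * (m.choose j : ℝ) := by
          rw [Finset.sum_mul]
          refine Finset.sum_le_sum fun j hj => ?_
          rw [mul_comm]
          gcongr ?_ * _
          exact pow_le_pow_of_le_one hq0.le hq1 (Nat.lt_succ_iff.1 (Finset.mem_range.1 hj))
      _ ≤ ∑ j ∈ Finset.range (m + 1), (d / m : ℝ) ^ j * (m.choose j : ℝ) := by
          refine Finset.sum_le_sum_of_subset_of_nonneg ?_ fun _ _ _ => by positivity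
          exact Finset.range_subset_range.2 (by omega)
      _ = (d / m + 1 : ℝ) ^ m := by
          rw [add_pow]; simp
      _ ≤ Real.exp (d / m) ^ m := by
          gcongr; exact Real.add_one_le_exp _
      _ = Real.exp 1 ^ d := by
          rw [← Real.exp_nat_mul, ← Real.exp_nat_mul]
          congr 1; field_simp
  have : (Real.exp 1 * m / d) ^ d = Real.exp 1 ^ d / (d / m : ℝ) ^ d := by
    rw [← div_pow]; congr 1; field_simp
  rw [this, le_div_iff₀ (by positivity)]
  exact key

open Classical in
/-- Sauer-Shelah for the 0-1 patterns that a class of functions realizes on a finite family. -/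
theorem card_patterns_le {Z ι : Type*} [Fintype ι] (H : Set (Z → Bool)) {d : ℕ}
    (hd : vcDim H = d) (z : ι → Z) :
    (Finset.univ.filter fun b : ι → Bool => ∃ h ∈ H, ∀ i, h (z i) = b i).card ≤
      ∑ j ∈ Finset.range (d + 1), (Fintype.card ι).choose j := by
  set A : Finset (Finset ι) :=
    (Finset.univ.filter fun b : ι → Bool => ∃ h ∈ H, ∀ i, h (z i) = b i).image
      fun b => Finset.univ.filter fun i => b i = true with hA
  have hmemA : ∀ t, t ∈ A → ∃ h ∈ H, ∀ i, h (z i) = true ↔ i ∈ t := by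
    intro t ht
    simp only [hA, Finset.mem_image, Finset.mem_filter, Finset.mem_univ, true_and] at ht
    obtain ⟨b, ⟨h, hh, hb⟩, rfl⟩ := ht
    exact ⟨h, hh, fun i => by simp [hb i]⟩
  have hcard : A.card =
      (Finset.univ.filter fun b : ι → Bool => ∃ h ∈ H, ∀ i, h (z i) = b i).card := by
    refine Finset.card_image_of_injective _ fun b c hbc => ?_
    funext i
    have := Finset.ext_iff.1 hbc i
    simp only [Finset.mem_filter, Finset.mem_univ, true_and] at this
    exact Bool.eq_iff_iff.2 this
  have hvc : A.vcDim ≤ d := by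
    refine Finset.sup_le fun s hs => ?_
    rw [Finset.mem_shatterer] at hs
    -- Two indices with the same point always receive the same label, so a shattered index set
    -- cannot contain both. Hence its image in `Z` has the same cardinality.
    have hinj : Set.InjOn z s := by
      intro i hi j hj hij
      obtain ⟨t, ht, hst⟩ := hs.exists_inter_eq_singleton hi
      obtain ⟨h, -, hh⟩ := hmemA t ht
      have hit : i ∈ t := (Finset.mem_inter.1 (hst ▸ Finset.mem_singleton_self i)).2
      have hjt : j ∈ t := (hh j).1 (hij ▸ (hh i).2 hit)
      have : j ∈ s ∩ t := Finset.mem_inter.2 ⟨hj, hjt⟩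
      rw [hst, Finset.mem_singleton] at this
      exact this.symm
    have hsh : Shatters H (s.image z) := by
      intro b
      obtain ⟨t, ht, hst⟩ := hs (Finset.filter_subset (fun i => b (z i) = true) s)
      obtain ⟨h, hhH, hh⟩ := hmemA t ht
      refine ⟨h, hhH, fun y hy => ?_⟩
      obtain ⟨i, hi, rfl⟩ := Finset.mem_image.1 hy
      have := Finset.ext_iff.1 hst i
      simp only [Finset.mem_inter, Finset.mem_filter, hi, true_and] at this
      exact Bool.eq_iff_iff.2 ((hh i).trans this)
    have h1 : ((s.image z).card : ℕ∞) ≤ vcDim H := le_iSup₂_of_le (s.image z) hsh le_rfl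
    rw [hd, Finset.card_image_of_injOn hinj] at h1
    exact_mod_cast h1
  rw [← hcard]
  refine A.card_le_card_shatterer.trans (Finset.card_shatterer_le_sum_vcDim.trans ?_)
  rw [Nat.range_succ_eq_Iic]
  exact Finset.sum_le_sum_of_subset (Finset.Iic_subset_Iic.2 hvc)

/-! ### Pinsker's inequality by duality -/

/-- The Fenchel-Young inequality for `klFun`. -/
theorem mul_le_klFun_add_exp {t u : ℝ} (ht : 0 ≤ t) : t * u ≤ klFun t + (Real.exp u - 1) := by
  rw [klFun_apply]
  rcases ht.eq_or_lt with rfl | ht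
  · simp; positivity
  · have h := Real.add_one_le_exp (u - Real.log t)
    rw [Real.exp_sub, Real.exp_log ht, le_div_iff₀ ht] at h
    linarith

/-- Pinsker's inequality, for the means of a function with values in `[0, 1]`. -/
theorem two_mul_sq_integral_sub_le_klDiv {Z : Type*} [MeasurableSpace Z] (μ ν : Measure Z)
    [IsProbabilityMeasure μ] [IsProbabilityMeasure ν] {f : Z → ℝ} (hf : Measurable f)
    (hf01 : ∀ z, f z ∈ Set.Icc (0 : ℝ) 1) (h : klDiv μ ν ≠ ∞) :
    2 * (∫ z, f z ∂ν - ∫ z, f z ∂μ) ^ 2 ≤ (klDiv μ ν).toReal := by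
  obtain ⟨hac, hint⟩ := klDiv_ne_top_iff.1 h
  set m := ∫ z, f z ∂ν with hm
  set t := m - ∫ z, f z ∂μ with ht
  have hsub := hasSubgaussianMGF_of_mem_Icc (μ := ν) hf.aemeasurable (ae_of_all _ hf01)
  -- Hoeffding's lemma bounds the centered moment generating function at `s` by `exp (s ^ 2 / 8)`.
  -- The dual lower bound `-s * t - s ^ 2 / 8` for the divergence is maximal at `s = -4 * t`, with
  -- value `2 * t ^ 2`.
  have hmgf := hsub.mgf_le (-(4 * t))
  have hexpint := hsub.integrable_exp_mul (-(4 * t))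
  rw [mgf] at hmgf
  simp only [← hm] at hmgf hexpint
  set c : ℝ := 2 * t ^ 2 with hc
  have hc' : (((‖(1 : ℝ) - 0‖₊ / 2) ^ 2 : NNReal) : ℝ) * (-(4 * t)) ^ 2 / 2 = c := by
    simp [hc]; ring
  rw [hc'] at hmgf
  set u : Z → ℝ := fun z => -(4 * t) * (f z - m) - c with hu
  have hfμ : Integrable f μ := Integrable.of_mem_Icc 0 1 hf.aemeasurable (ae_of_all _ hf01)
  have huμ : Integrable u μ := ((hfμ.sub (integrable_const m)).const_mul _).sub (integrable_const c)
  have hexpu : (fun z => Real.exp (u z)) =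
      fun z => Real.exp (-c) * Real.exp (-(4 * t) * (f z - m)) := by
    funext z; rw [← Real.exp_add]; congr 1; simp [hu]; ring
  have hexpu_int : Integrable (fun z => Real.exp (u z)) ν := by
    rw [hexpu]; exact hexpint.const_mul _
  have hexpu_le : ∫ z, Real.exp (u z) ∂ν ≤ 1 := by
    rw [hexpu, integral_const_mul]
    calc Real.exp (-c) * _ ≤ Real.exp (-c) * Real.exp c := by gcongr
      _ = 1 := by rw [← Real.exp_add]; simp
  have hkl_int : Integrable (fun z => klFun (μ.rnDeriv ν z).toReal) ν :=
    (integrable_klFun_rnDeriv_iff hac).2 hint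
  have h1 : ∫ z, u z ∂μ = ∫ z, (μ.rnDeriv ν z).toReal * u z ∂ν := by
    simpa using (integral_rnDeriv_smul hac (f := u)).symm
  -- Fenchel-Young, integrated against `ν`. The subtraction of `c` in `u` makes the integral of `exp
  -- u - 1` nonpositive, so only the divergence remains.
  have h2 : ∫ z, (μ.rnDeriv ν z).toReal * u z ∂ν ≤
      ∫ z, (klFun (μ.rnDeriv ν z).toReal + (Real.exp (u z) - 1)) ∂ν := by
    refine integral_mono ?_ (hkl_int.add (hexpu_int.sub (integrable_const 1)))
      fun z => mul_le_klFun_add_exp ENNReal.toReal_nonneg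
    simpa using (integrable_rnDeriv_smul_iff hac (f := u)).2 huμ
  have hexpu_sub : Integrable (fun z => Real.exp (u z) - 1) ν := hexpu_int.sub (integrable_const 1)
  rw [integral_add hkl_int hexpu_sub,
    integral_sub hexpu_int (integrable_const 1), ← toReal_klDiv_eq_integral_klFun hac] at h2
  have h3 : ∫ z, u z ∂μ = 4 * t * t - c := by
    simp only [hu]
    have hfm : Integrable (fun z => -(4 * t) * (f z - m)) μ :=
      (hfμ.sub (integrable_const m)).const_mul _
    rw [integral_sub hfm (integrable_const c), integral_const_mul, integral_sub hfμ (integrable_const m)]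
    simp [ht]; ring
  rw [← h1, h3] at h2
  simp at h2
  rw [hc] at h2
  nlinarith

/-! ### Pair swaps and Rademacher sums -/

theorem zeroOneLoss_nonneg (a b : Bool) : 0 ≤ zeroOneLoss a b := by
  unfold zeroOneLoss; split_ifs <;> norm_num

theorem zeroOneLoss_le_one (a b : Bool) : zeroOneLoss a b ≤ 1 := by
  unfold zeroOneLoss; split_ifs <;> norm_num

theorem measurable_zeroOneLoss {W : Type*} [MeasurableSpace W] {f g : W → Bool}
    (hf : Measurable f) (hg : Measurable g) : Measurable fun w => zeroOneLoss (f w) (g w) :=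
  (measurable_of_countable fun p : Bool × Bool => zeroOneLoss p.1 p.2).comp (hf.prodMk hg)

/-- The permutation of a double sample that exchanges the `i`-th points of the two halves whenever
`τ i` holds. -/
def swapPairs {ι : Type*} (τ : ι → Bool) : Equiv.Perm (ι ⊕ ι) :=
  Function.Involutive.toPerm
    (Sum.elim (fun i => if τ i then Sum.inr i else Sum.inl i)
      (fun i => if τ i then Sum.inl i else Sum.inr i))
    (by rintro (i | i) <;> cases h : τ i <;> simp [h])

/-- The number of errors of the predictions `b` for the labels `t` on the second half of a double
sample, minus the number of errors on the first half. -/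
noncomputable def pairDev {ι : Type*} [Fintype ι] (b t : ι ⊕ ι → Bool) : ℝ :=
  ∑ i, (zeroOneLoss (b (Sum.inr i)) (t (Sum.inr i)) - zeroOneLoss (b (Sum.inl i)) (t (Sum.inl i)))

/-- Exchanging the two points of a pair negates that pair's contribution, so `τ` acts as a choice of
signs. -/
theorem pairDev_comp_swapPairs {ι : Type*} [Fintype ι] (b t : ι ⊕ ι → Bool) (τ : ι → Bool) :
    pairDev (b ∘ swapPairs τ) (t ∘ swapPairs τ) = ∑ i, (if τ i then -1 else 1) *
      (zeroOneLoss (b (Sum.inr i)) (t (Sum.inr i)) -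
        zeroOneLoss (b (Sum.inl i)) (t (Sum.inl i))) := by
  refine Finset.sum_congr rfl fun i _ => ?_
  have hl : swapPairs τ (Sum.inl i) = if τ i then Sum.inr i else Sum.inl i := rfl
  have hr : swapPairs τ (Sum.inr i) = if τ i then Sum.inl i else Sum.inr i := rfl
  cases h : τ i <;> simp [hl, hr, h]

/-- The exponential moment of a Rademacher sum with coefficients in `[-1, 1]`. -/
theorem sum_exp_signs_le {ι : Type*} [Fintype ι] [DecidableEq ι] (a : ι → ℝ)
    (ha : ∀ i, |a i| ≤ 1) (ε : ℝ) :
    ∑ τ : ι → Bool, Real.exp (ε * ∑ i, (if τ i then -1 else 1) * a i) ≤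
      2 ^ Fintype.card ι * Real.exp (Fintype.card ι * ε ^ 2 / 2) := by
  have h1 : ∑ τ : ι → Bool, Real.exp (ε * ∑ i, (if τ i then -1 else 1) * a i) =
      ∏ i, ∑ s : Bool, Real.exp (ε * ((if s then -1 else 1) * a i)) := by
    rw [Finset.prod_univ_sum]
    simp only [Fintype.piFinset_univ, Finset.mul_sum, Real.exp_sum]
  rw [h1]
  calc ∏ i, ∑ s : Bool, Real.exp (ε * ((if s then -1 else 1) * a i))
      ≤ ∏ _i : ι, (2 * Real.exp (ε ^ 2 / 2)) := by
        refine Finset.prod_le_prod (fun i _ => by positivity) fun i _ => ?_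
        have h2 : ∑ s : Bool, Real.exp (ε * ((if s then -1 else 1) * a i)) =
            2 * Real.cosh (ε * a i) := by
          rw [Real.cosh_eq]; simp; ring
        rw [h2]
        refine mul_le_mul_of_nonneg_left ((Real.cosh_le_exp_half_sq _).trans ?_) two_pos.le
        have h3 : a i ^ 2 ≤ 1 := (sq_le_one_iff_abs_le_one _).2 (ha i)
        have h4 : ε ^ 2 * a i ^ 2 ≤ ε ^ 2 * 1 := by gcongr
        refine Real.exp_le_exp.2 ?_
        rw [mul_pow]; linarith
    _ = 2 ^ Fintype.card ι * Real.exp (Fintype.card ι * ε ^ 2 / 2) := by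
        rw [Finset.prod_const, mul_pow, ← Real.exp_nat_mul, Finset.card_univ]
        congr 2; ring

/-- A product of equal factors is invariant under permutations of the coordinates. -/
theorem measurePreserving_comp_perm {W ι ι' : Type*} [Fintype ι] [Fintype ι'] [MeasurableSpace W]
    (μ : Measure W) [SigmaFinite μ] (e : ι ≃ ι') :
    MeasurePreserving (fun s : ι' → W => s ∘ e) (Measure.pi fun _ => μ) (Measure.pi fun _ => μ) := by
  have h := measurePreserving_piCongrLeft (fun _ : ι => μ) e.symm
  convert! h using 1
  funext s i
  simpa using (MeasurableEquiv.piCongrLeft_apply_apply e.symm (β := fun _ : ι => W) s (e i)).symm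

/-! ### Symmetrization with a ghost sample -/

section Symmetrization

variable {W Z : Type*} (H : Set (Z → Bool)) (ψ : W → Z)
  (y : W → Bool)

/-- The samples on which some member of `H` realizes the pattern `b`. -/
def realizing {ι : Type*} (b : ι → Bool) : Set (ι → W) :=
  {s | ∃ h ∈ H, ∀ i, h (ψ (s i)) = b i}

/-- The sum of the exponential weights `exp (ε * pairDev)` of the patterns that `H` realizes on a
double sample. -/
noncomputable def patternSum {ι : Type*} [Fintype ι] [DecidableEq ι] (ε : ℝ) (s : ι ⊕ ι → W) :
    ℝ≥0∞ :=
  ∑ b : ι ⊕ ι → Bool,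
    (realizing H ψ b).indicator (fun s => ENNReal.ofReal (Real.exp (ε * pairDev b (y ∘ s)))) s

variable {H ψ y}

/-- The swaps act on samples and patterns alike, so the realized patterns can be held fixed while
`τ` varies. Each of them then contributes a Rademacher exponential moment, and Sauer-Shelah bounds
their number. The bound is pointwise in the sample. -/
theorem sum_patternSum_swapPairs_le {ι : Type*} [Fintype ι] [DecidableEq ι] {d : ℕ}
    (hd : vcDim H = d) (ε : ℝ) (s : ι ⊕ ι → W) :
    ∑ τ : ι → Bool, patternSum H ψ y ε (s ∘ swapPairs τ) ≤
      (∑ j ∈ Finset.range (d + 1), (2 * Fintype.card ι).choose j : ℕ) *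
        ENNReal.ofReal (2 ^ Fintype.card ι * Real.exp (Fintype.card ι * ε ^ 2 / 2)) := by
  classical
  have h1 : ∀ τ : ι → Bool, patternSum H ψ y ε (s ∘ swapPairs τ) =
      ∑ c : ι ⊕ ι → Bool, if s ∈ realizing H ψ c then
        ENNReal.ofReal (Real.exp (ε * pairDev (c ∘ swapPairs τ) ((y ∘ s) ∘ swapPairs τ)))
        else 0 := by
    intro τ
    unfold patternSum
    -- Reindexed by `c ↦ c ∘ swapPairs τ`, the condition that a pattern is realized no longer
    -- depends on `τ`.
    rw [← Equiv.sum_comp ((swapPairs τ).symm.arrowCongr (Equiv.refl Bool))]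
    refine Finset.sum_congr rfl fun c _ => ?_
    have hc : ((swapPairs τ).symm.arrowCongr (Equiv.refl Bool)) c = c ∘ swapPairs τ := by
      funext i; simp
    rw [hc, Set.indicator_apply]
    refine if_congr ?_ rfl rfl
    simp only [realizing, Set.mem_ofPred_eq, Function.comp_apply]
    exact exists_congr fun h => and_congr_right fun _ =>
      ⟨fun hs i => by simpa using hs ((swapPairs τ).symm i), fun hs i => hs _⟩
  simp_rw [h1]
  rw [Finset.sum_comm]
  have h2 : ∀ c : ι ⊕ ι → Bool, (∑ τ : ι → Bool, if s ∈ realizing H ψ c then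
        ENNReal.ofReal (Real.exp (ε * pairDev (c ∘ swapPairs τ) ((y ∘ s) ∘ swapPairs τ)))
        else 0) ≤ if s ∈ realizing H ψ c then
        ENNReal.ofReal (2 ^ Fintype.card ι * Real.exp (Fintype.card ι * ε ^ 2 / 2)) else 0 := by
    intro c
    split_ifs
    · rw [← ENNReal.ofReal_sum_of_nonneg fun _ _ => (Real.exp_pos _).le]
      refine ENNReal.ofReal_le_ofReal ?_
      simp_rw [pairDev_comp_swapPairs]
      refine sum_exp_signs_le _ (fun i => ?_) ε
      rw [abs_le]
      constructor <;>
        linarith [zeroOneLoss_nonneg (c (Sum.inr i)) ((y ∘ s) (Sum.inr i)),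
          zeroOneLoss_nonneg (c (Sum.inl i)) ((y ∘ s) (Sum.inl i)),
          zeroOneLoss_le_one (c (Sum.inr i)) ((y ∘ s) (Sum.inr i)),
          zeroOneLoss_le_one (c (Sum.inl i)) ((y ∘ s) (Sum.inl i))]
    · simp
  refine (Finset.sum_le_sum fun c _ => h2 c).trans ?_
  rw [← Finset.sum_filter, Finset.sum_const, nsmul_eq_mul]
  gcongr
  have := card_patterns_le H hd (fun i => ψ (s i))
  rw [Fintype.card_sum, ← two_mul] at this
  convert! this

variable [MeasurableSpace W] [MeasurableSpace Z]

theorem nullMeasurableSet_realizing {ι : Type*} [Fintype ι] (μ : Measure W)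
    [IsProbabilityMeasure μ] (hψ : Measurable ψ) (hH : HasMeasurableTraces H (μ.map ψ))
    (b : ι → Bool) : NullMeasurableSet (realizing H ψ b) (Measure.pi fun _ => μ) := by
  have : IsProbabilityMeasure (μ.map ψ) := Measure.isProbabilityMeasure_map hψ.aemeasurable
  let e := (Fintype.equivFin ι).symm
  have h1 : MeasurePreserving (fun s : ι → W => s ∘ e) (Measure.pi fun _ => μ)
      (Measure.pi fun _ => μ) := measurePreserving_comp_perm μ e
  have h2 : MeasurePreserving (fun (s : Fin (Fintype.card ι) → W) i => ψ (s i))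
      (Measure.pi fun _ => μ) (Measure.pi fun _ => μ.map ψ) :=
    measurePreserving_pi _ _ fun _ => ⟨hψ, rfl⟩
  convert! (hH _ (b ∘ e)).preimage (h2.comp h1).quasiMeasurePreserving using 1
  ext s
  simp only [realizing, Set.mem_ofPred_eq, Set.mem_preimage, Function.comp_apply]
  exact exists_congr fun h => and_congr_right fun _ => ⟨fun hs i => hs (e i), fun hs i => by
    simpa using hs (e.symm i)⟩

theorem measurable_exp_pairDev {ι : Type*} [Fintype ι] (hy : Measurable y) (ε : ℝ)
    (b : ι ⊕ ι → Bool) :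
    Measurable fun s : ι ⊕ ι → W => ENNReal.ofReal (Real.exp (ε * pairDev b (y ∘ s))) := by
  unfold pairDev
  refine ENNReal.measurable_ofReal.comp (Real.measurable_exp.comp (Measurable.const_mul ?_ _))
  refine Finset.measurable_sum _ fun i _ => ?_
  exact (measurable_zeroOneLoss measurable_const (hy.comp (measurable_pi_apply _))).sub
    (measurable_zeroOneLoss measurable_const (hy.comp (measurable_pi_apply _)))

theorem aemeasurable_patternSum {ι : Type*} [Fintype ι] [DecidableEq ι] (μ : Measure W)
    [IsProbabilityMeasure μ] (hψ : Measurable ψ) (hy : Measurable y)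
    (hH : HasMeasurableTraces H (μ.map ψ)) (ε : ℝ) :
    AEMeasurable (patternSum (ι := ι) H ψ y ε) (Measure.pi fun _ => μ) := by
  unfold patternSum
  exact Finset.aemeasurable_fun_sum _ fun b _ =>
    (measurable_exp_pairDev hy ε b).aemeasurable.indicator₀
      (nullMeasurableSet_realizing μ hψ hH b)

/-- Every swap preserves the product law, so the integral equals its average over all `2 ^ n` swaps,
where `n` is the number of pairs. The pointwise bound applies under the integral. -/
theorem lintegral_patternSum_le {ι : Type*} [Fintype ι] [DecidableEq ι] (μ : Measure W)
    [IsProbabilityMeasure μ] (hψ : Measurable ψ) (hy : Measurable y)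
    (hH : HasMeasurableTraces H (μ.map ψ)) {d : ℕ} (hd : vcDim H = d) (ε : ℝ) :
    ∫⁻ s : ι ⊕ ι → W, patternSum H ψ y ε s ∂(Measure.pi fun _ => μ) ≤
      (∑ j ∈ Finset.range (d + 1), (2 * Fintype.card ι).choose j : ℕ) *
        ENNReal.ofReal (Real.exp (Fintype.card ι * ε ^ 2 / 2)) := by
  have hF := aemeasurable_patternSum (ι := ι) μ hψ hy hH ε
  have hmp : ∀ τ : ι → Bool, MeasurePreserving (fun s : ι ⊕ ι → W => s ∘ swapPairs τ)
      (Measure.pi fun _ => μ) (Measure.pi fun _ => μ) :=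
    fun τ => measurePreserving_comp_perm μ (swapPairs τ)
  have hswap : ∀ τ : ι → Bool,
      ∫⁻ s : ι ⊕ ι → W, patternSum H ψ y ε (s ∘ swapPairs τ) ∂(Measure.pi fun _ => μ) =
        ∫⁻ s : ι ⊕ ι → W, patternSum H ψ y ε s ∂(Measure.pi fun _ => μ) := by
    intro τ
    have hF' : AEMeasurable (patternSum H ψ y ε) (Measure.map (fun s : ι ⊕ ι → W => s ∘ swapPairs τ)
        (Measure.pi fun _ => μ)) := by rwa [(hmp τ).map_eq]
    rw [← lintegral_map' hF' (hmp τ).measurable.aemeasurable, (hmp τ).map_eq]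
  have hsum : (2 ^ Fintype.card ι : ℝ≥0∞) *
      ∫⁻ s : ι ⊕ ι → W, patternSum H ψ y ε s ∂(Measure.pi fun _ => μ) ≤
      (2 ^ Fintype.card ι : ℝ≥0∞) *
      ((∑ j ∈ Finset.range (d + 1), (2 * Fintype.card ι).choose j : ℕ) *
        ENNReal.ofReal (Real.exp (Fintype.card ι * ε ^ 2 / 2))) := by
    calc (2 ^ Fintype.card ι : ℝ≥0∞) *
        ∫⁻ s : ι ⊕ ι → W, patternSum H ψ y ε s ∂(Measure.pi fun _ => μ)
        = ∑ τ : ι → Bool, ∫⁻ s : ι ⊕ ι → W, patternSum H ψ y ε (s ∘ swapPairs τ)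
            ∂(Measure.pi fun _ => μ) := by
          simp [hswap]
      _ = ∫⁻ s : ι ⊕ ι → W, ∑ τ : ι → Bool, patternSum H ψ y ε (s ∘ swapPairs τ)
            ∂(Measure.pi fun _ => μ) :=
          (lintegral_finsetSum' _ fun τ _ =>
            hF.comp_quasiMeasurePreserving (hmp τ).quasiMeasurePreserving).symm
      _ ≤ ∫⁻ _s : ι ⊕ ι → W, (∑ j ∈ Finset.range (d + 1), (2 * Fintype.card ι).choose j : ℕ) *
            ENNReal.ofReal (2 ^ Fintype.card ι * Real.exp (Fintype.card ι * ε ^ 2 / 2))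
            ∂(Measure.pi fun _ => μ) :=
          lintegral_mono fun s => sum_patternSum_swapPairs_le hd ε s
      _ = _ := by
          rw [lintegral_const, measure_univ, mul_one, ENNReal.ofReal_mul (by positivity),
            ENNReal.ofReal_pow two_pos.le, ENNReal.ofReal_ofNat]
          ring
  exact (ENNReal.mul_le_mul_iff_right (by positivity) (by finiteness)).1 hsum

/-- Jensen's inequality for the exponential function and a bounded random variable. -/
theorem ofReal_exp_integral_le {Ω : Type*} [MeasurableSpace Ω] (ν : Measure Ω)
    [IsProbabilityMeasure ν] {f : Ω → ℝ} (hf : Measurable f) {C : ℝ} (hC : ∀ ω, |f ω| ≤ C) :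
    ENNReal.ofReal (Real.exp (∫ ω, f ω ∂ν)) ≤ ∫⁻ ω, ENNReal.ofReal (Real.exp (f ω)) ∂ν := by
  have hfi : Integrable f ν :=
    Integrable.of_bound hf.aestronglyMeasurable C (ae_of_all _ hC)
  have hei : Integrable (fun ω => Real.exp (f ω)) ν := by
    refine Integrable.of_bound (Real.measurable_exp.comp hf).aestronglyMeasurable (Real.exp C)
      (ae_of_all _ fun ω => ?_)
    rw [Real.norm_eq_abs, abs_of_pos (Real.exp_pos _)]
    exact Real.exp_le_exp.2 ((le_abs_self _).trans (hC ω))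
  rw [← ofReal_integral_eq_lintegral_ofReal hei (ae_of_all _ fun ω => (Real.exp_pos _).le)]
  refine ENNReal.ofReal_le_ofReal ?_
  exact convexOn_exp.map_integral_le Real.continuous_exp.continuousOn isClosed_univ
    (by simp) hfi hei

/-- One-sided uniform deviation bound, in terms of the number of patterns on a double sample. -/
theorem measure_exists_deviation_le {n : ℕ} (μ : Measure W)
    [IsProbabilityMeasure μ] (hψ : Measurable ψ) (hy : Measurable y)
    (hHm : ∀ h ∈ H, Measurable h)
    (hH : HasMeasurableTraces H (μ.map ψ)) {d : ℕ} (hd : vcDim H = d) {ε : ℝ} (hε : 0 ≤ ε) :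
    Measure.pi (fun _ : Fin n => μ) {s | ∃ h ∈ H,
      n * ε < n * (∫ w, zeroOneLoss (h (ψ w)) (y w) ∂μ) -
        ∑ i, zeroOneLoss (h (ψ (s i))) (y (s i))} ≤
      ENNReal.ofReal ((∑ j ∈ Finset.range (d + 1), ((2 * n).choose j : ℝ)) *
        Real.exp (-(n * ε ^ 2 / 2))) := by
  set ν := Measure.pi (fun _ : Fin n => μ)
  have hmp : MeasurePreserving (MeasurableEquiv.sumPiEquivProdPi fun _ : Fin n ⊕ Fin n => W).symm
      (ν.prod ν) (Measure.pi fun _ => μ) :=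
    measurePreserving_sumPiEquivProdPi_symm fun _ : Fin n ⊕ Fin n => μ
  have hF := aemeasurable_patternSum (ι := Fin n) μ hψ hy hH ε
  set F' : (Fin n → W) × (Fin n → W) → ℝ≥0∞ := fun p => patternSum H ψ y ε
    ((MeasurableEquiv.sumPiEquivProdPi fun _ : Fin n ⊕ Fin n => W).symm p) with hF'
  have hF'm : AEMeasurable F' (ν.prod ν) :=
    hF.comp_quasiMeasurePreserving hmp.quasiMeasurePreserving
  have hint : ∫⁻ s, ∫⁻ s', F' (s, s') ∂ν ∂ν ≤
      (∑ j ∈ Finset.range (d + 1), (2 * n).choose j : ℕ) *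
        ENNReal.ofReal (Real.exp (n * ε ^ 2 / 2)) := by
    rw [← lintegral_prod _ hF'm]
    have hF2 : AEMeasurable (patternSum H ψ y ε) (Measure.map
        (MeasurableEquiv.sumPiEquivProdPi fun _ : Fin n ⊕ Fin n => W).symm (ν.prod ν)) := by
      rwa [hmp.map_eq]
    rw [hF', ← lintegral_map' hF2 hmp.measurable.aemeasurable, hmp.map_eq]
    simpa using lintegral_patternSum_le (ι := Fin n) μ hψ hy hH hd ε
  -- The bad event itself need not be measurable. It is enough to cover it by a superlevel set of
  -- the a.e. measurable ghost-sample mean of `patternSum`.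
  have hsub : {s : Fin n → W | ∃ h ∈ H, n * ε < n * (∫ w, zeroOneLoss (h (ψ w)) (y w) ∂μ) -
        ∑ i, zeroOneLoss (h (ψ (s i))) (y (s i))} ⊆
      {s | ENNReal.ofReal (Real.exp (n * ε ^ 2)) ≤ ∫⁻ s', F' (s, s') ∂ν} := by
    rintro s ⟨h, hh, hs⟩
    have hℓ : Measurable fun w => zeroOneLoss (h (ψ w)) (y w) :=
      measurable_zeroOneLoss ((hHm h hh).comp hψ) hy
    have hcoord : ∀ i : Fin n,
        Measurable fun s' : Fin n → W => zeroOneLoss (h (ψ (s' i))) (y (s' i)) :=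
      fun i => hℓ.comp (measurable_pi_apply i)
    set dev : (Fin n → W) → ℝ := fun s' => ε * ∑ i, (zeroOneLoss (h (ψ (s' i))) (y (s' i)) -
      zeroOneLoss (h (ψ (s i))) (y (s i))) with hdev
    have hdevm : Measurable dev :=
      (Finset.measurable_sum _ fun i _ => (hcoord i).sub_const _).const_mul _
    have hdevb : ∀ s', |dev s'| ≤ ε * n := by
      intro s'
      rw [hdev, abs_mul, abs_of_nonneg hε]
      gcongr
      refine (Finset.abs_sum_le_sum_abs _ _).trans ?_
      calc _ ≤ ∑ _i : Fin n, (1 : ℝ) := Finset.sum_le_sum fun i _ => by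
            rw [abs_le]
            constructor <;>
              linarith [zeroOneLoss_nonneg (h (ψ (s i))) (y (s i)),
                zeroOneLoss_nonneg (h (ψ (s' i))) (y (s' i)),
                zeroOneLoss_le_one (h (ψ (s i))) (y (s i)),
                zeroOneLoss_le_one (h (ψ (s' i))) (y (s' i))]
        _ = n := by simp
    have hdevint : ∫ s', dev s' ∂ν = ε * (n * (∫ w, zeroOneLoss (h (ψ w)) (y w) ∂μ) -
        ∑ i, zeroOneLoss (h (ψ (s i))) (y (s i))) := by
      have hev : ∀ i : Fin n, ∫ s', zeroOneLoss (h (ψ (s' i))) (y (s' i)) ∂ν =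
          ∫ w, zeroOneLoss (h (ψ w)) (y w) ∂μ := by
        intro i
        have := (measurePreserving_eval (fun _ : Fin n => μ) i)
        rw [← this.map_eq, integral_map this.measurable.aemeasurable hℓ.aestronglyMeasurable]
      have hevi : ∀ i : Fin n, Integrable (fun s' : Fin n → W =>
          zeroOneLoss (h (ψ (s' i))) (y (s' i))) ν := fun i =>
        Integrable.of_mem_Icc 0 1 (hcoord i).aemeasurable
          (ae_of_all _ fun w => ⟨zeroOneLoss_nonneg _ _, zeroOneLoss_le_one _ _⟩)
      have hdiff : ∀ i : Fin n, Integrable (fun s' : Fin n → W =>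
          zeroOneLoss (h (ψ (s' i))) (y (s' i)) - zeroOneLoss (h (ψ (s i))) (y (s i))) ν :=
        fun i => (hevi i).sub (integrable_const _)
      have hdiffint : ∀ i : Fin n, ∫ s', (zeroOneLoss (h (ψ (s' i))) (y (s' i)) -
          zeroOneLoss (h (ψ (s i))) (y (s i))) ∂ν =
            ∫ w, zeroOneLoss (h (ψ w)) (y w) ∂μ - zeroOneLoss (h (ψ (s i))) (y (s i)) := by
        intro i
        rw [integral_sub (hevi i) (integrable_const _), hev]
        simp
      rw [hdev, integral_const_mul, integral_finsetSum _ fun i _ => hdiff i]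
      simp [hdiffint]
    calc ENNReal.ofReal (Real.exp (n * ε ^ 2))
        ≤ ENNReal.ofReal (Real.exp (∫ s', dev s' ∂ν)) := by
          refine ENNReal.ofReal_le_ofReal (Real.exp_le_exp.2 ?_)
          rw [hdevint]
          nlinarith
      _ ≤ ∫⁻ s', ENNReal.ofReal (Real.exp (dev s')) ∂ν := ofReal_exp_integral_le ν hdevm hdevb
      _ ≤ ∫⁻ s', F' (s, s') ∂ν := by
          refine lintegral_mono fun s' => ?_
          set S : Fin n ⊕ Fin n → W :=
            (MeasurableEquiv.sumPiEquivProdPi fun _ : Fin n ⊕ Fin n => W).symm (s, s') with hS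
          have hSl : ∀ i, S (Sum.inl i) = s i := fun i => rfl
          have hSr : ∀ i, S (Sum.inr i) = s' i := fun i => rfl
          -- The pattern of `h` on the double sample is realized by `h` itself, so its weight is one
          -- term of `patternSum`.
          have hmem : S ∈ realizing H ψ fun j => h (ψ (S j)) := ⟨h, hh, fun _ => rfl⟩
          have := Finset.single_le_sum (f := fun b : Fin n ⊕ Fin n → Bool =>
            (realizing H ψ b).indicator
              (fun s => ENNReal.ofReal (Real.exp (ε * pairDev b (y ∘ s)))) S)
            (fun _ _ => zero_le) (Finset.mem_univ fun j => h (ψ (S j)))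
          simp only [Set.indicator_of_mem hmem] at this
          simpa only [hF', patternSum, pairDev, Function.comp_apply, hSl, hSr, hdev] using this
  -- The threshold `exp (n * ε ^ 2)` against the factor `exp (n * ε ^ 2 / 2)` in the mean leaves
  -- `exp (-(n * ε ^ 2 / 2))`.
  have hmarkov := meas_ge_le_lintegral_div hF'm.lintegral_prod_right'
    (ε := ENNReal.ofReal (Real.exp (n * ε ^ 2))) (by simpa using Real.exp_pos _)
    ENNReal.ofReal_ne_top
  refine (measure_mono hsub).trans (hmarkov.trans ((ENNReal.div_le_div_right hint _).trans ?_))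
  rw [← ENNReal.ofReal_natCast, ← ENNReal.ofReal_mul (by positivity),
    ← ENNReal.ofReal_div_of_pos (Real.exp_pos _)]
  refine ENNReal.ofReal_le_ofReal (le_of_eq ?_)
  push_cast
  rw [mul_div_assoc, ← Real.exp_sub]
  congr 2; ring

end Symmetrization

/-! ### Risk bounds for i.i.d. labeled samples -/

/-- The factor `4 / n` makes the exponent twice `a + log (4 / δ)`, with `exp a` bounding the pattern
count. One copy already gives `δ / 4`, so the constants have slack. -/
theorem sum_choose_mul_exp_complexityTerm_le {n d : ℕ} (hn : 0 < n) (hd : d ≤ 2 * n) {δ : ℝ}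
    (hδ : 0 < δ) (hδ1 : δ ≤ 1) :
    (∑ j ∈ Finset.range (d + 1), ((2 * n).choose j : ℝ)) *
      Real.exp (-(n * complexityTerm n d δ ^ 2 / 2)) ≤ δ / 2 := by
  have hn' : (0 : ℝ) < n := by exact_mod_cast hn
  have hlog4 : 0 ≤ Real.log (4 / δ) := Real.log_nonneg (by rw [le_div_iff₀ hδ]; linarith)
  set a : ℝ := d * Real.log (2 * Real.exp 1 * n / d) with ha
  have hS : (∑ j ∈ Finset.range (d + 1), ((2 * n).choose j : ℝ)) ≤ Real.exp a ∧ 0 ≤ a := by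
    -- For `d = 0` the factor `d` annihilates the logarithm of the quotient by zero, and the
    -- binomial sum is `1 = exp 0`.
    rcases Nat.eq_zero_or_pos d with rfl | hd0
    · simp [ha]
    · have hd' : (0 : ℝ) < d := by exact_mod_cast hd0
      have hd2 : (d : ℝ) ≤ 2 * n := by exact_mod_cast hd
      refine ⟨(sum_choose_le_exp_mul_div_pow hd0 hd).trans (le_of_eq ?_), ?_⟩
      · rw [ha, Real.exp_nat_mul, Real.exp_log (by positivity)]
        push_cast; ring
      · refine mul_nonneg hd'.le (Real.log_nonneg ?_)
        rw [le_div_iff₀ hd']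
        nlinarith [Real.add_one_le_exp 1]
  obtain ⟨hS, ha0⟩ := hS
  have hsq : n * complexityTerm n d δ ^ 2 / 2 = 2 * (a + Real.log (4 / δ)) := by
    rw [complexityTerm, ← ha, Real.sq_sqrt (by positivity)]
    field_simp; ring
  rw [hsq]
  calc _ ≤ Real.exp a * Real.exp (-(a + Real.log (4 / δ))) := by
        gcongr; linarith
    _ = δ / 4 := by
        rw [← Real.exp_add, show a + -(a + Real.log (4 / δ)) = -Real.log (4 / δ) by ring,
          Real.exp_neg, Real.exp_log (by positivity), inv_div]
    _ ≤ δ / 2 := by linarith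

section SampleLaw

variable {X : Type*} [MeasurableSpace X] (μ : Measure X) {g : X → I}

theorem map_fst_sampleLaw (hg : Measurable g) : (sampleLaw μ g).map Prod.fst = μ := by
  have hm : Measurable fun x => ENNReal.ofReal (g x) :=
    ENNReal.measurable_ofReal.comp (measurable_subtype_coe.comp hg)
  rw [sampleLaw, Measure.map_add _ _ measurable_fst,
    Measure.map_map measurable_fst (by fun_prop), Measure.map_map measurable_fst (by fun_prop)]
  change Measure.map id _ + Measure.map id _ = _
  rw [Measure.map_id, Measure.map_id, ← withDensity_add_left hm]
  convert withDensity_one using 2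
  funext x
  simp only [Pi.add_apply, Pi.one_apply]
  rw [← ENNReal.ofReal_add (g x).2.1 (sub_nonneg.2 (g x).2.2)]
  simp

theorem isProbabilityMeasure_sampleLaw [IsProbabilityMeasure μ] (hg : Measurable g) :
    IsProbabilityMeasure (sampleLaw μ g) := by
  constructor
  have := congrArg (fun ν => ν Set.univ) (map_fst_sampleLaw μ hg)
  simpa [Measure.map_apply measurable_fst MeasurableSet.univ] using this

theorem integral_zeroOneLoss_sampleLaw [IsProbabilityMeasure μ] (hg : Measurable g) {f : X → Bool}
    (hf : Measurable f) :
    ∫ w, zeroOneLoss (f w.1) w.2 ∂(sampleLaw μ g) = risk μ f g := by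
  have hprob := isProbabilityMeasure_sampleLaw μ hg
  have hℓ : Measurable fun w : X × Bool => zeroOneLoss (f w.1) w.2 :=
    measurable_zeroOneLoss (hf.comp measurable_fst) measurable_snd
  have hgm : Measurable fun x => (g x : ℝ) := measurable_subtype_coe.comp hg
  have hi : Integrable (fun w : X × Bool => zeroOneLoss (f w.1) w.2) (sampleLaw μ g) :=
    Integrable.of_mem_Icc 0 1 hℓ.aemeasurable
      (ae_of_all _ fun w => ⟨zeroOneLoss_nonneg _ _, zeroOneLoss_le_one _ _⟩)
  have hb : ∀ (b : Bool) (p : X → ℝ), Measurable p → (∀ x, p x ∈ Set.Icc (0 : ℝ) 1) →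
      Integrable (fun x => p x * zeroOneLoss (f x) b) μ := fun b p hp hp1 =>
    Integrable.of_mem_Icc 0 1
      (hp.mul (measurable_zeroOneLoss hf measurable_const)).aemeasurable
      (ae_of_all _ fun x => ⟨mul_nonneg (hp1 x).1 (zeroOneLoss_nonneg _ _),
        mul_le_one₀ (hp1 x).2 (zeroOneLoss_nonneg _ _) (zeroOneLoss_le_one _ _)⟩)
  have hpart : ∀ (b : Bool) (p : X → ℝ), Measurable p → (∀ x, p x ∈ Set.Icc (0 : ℝ) 1) →
      ∫ w, zeroOneLoss (f w.1) w.2 ∂((μ.withDensity fun x => ENNReal.ofReal (p x)).map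
        fun x => (x, b)) = ∫ x, p x * zeroOneLoss (f x) b ∂μ := by
    intro b p hp hp1
    rw [integral_map (by fun_prop) hℓ.aestronglyMeasurable,
      integral_withDensity_eq_integral_toReal_smul (by fun_prop) (by simp)]
    refine integral_congr_ae (ae_of_all _ fun x => ?_)
    simp [ENNReal.toReal_ofReal (hp1 x).1]
  have hg1 : ∀ x, (1 - g x : ℝ) ∈ Set.Icc (0 : ℝ) 1 := fun x =>
    ⟨sub_nonneg.2 (g x).2.2, by linarith [(g x).2.1]⟩
  rw [sampleLaw] at hi ⊢
  rw [integral_add_measure hi.left_of_add_measure hi.right_of_add_measure,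
    hpart true _ hgm fun x => (g x).2, hpart false _ (hgm.const_sub 1) hg1, risk,
    ← integral_add (hb true _ hgm fun x => (g x).2) (hb false _ (hgm.const_sub 1) hg1)]
  rfl

/-- A uniform one-sided risk bound for an i.i.d. labeled sample, off a small measurable event. -/
theorem exists_event_risk_le {Z Ω : Type*} [MeasurableSpace Z] [MeasurableSpace Ω]
    [IsProbabilityMeasure μ] (hg : Measurable g) {φ : X → Z} (hφ : Measurable φ)
    {H : Set (Z → Bool)} {d : ℕ} (hd : vcDim H = d) (hHm : ∀ h ∈ H, Measurable h)
    (hH : HasMeasurableTraces H (μ.map φ)) {δ : ℝ} (hδ : 0 < δ) (hδ1 : δ ≤ 1) {n : ℕ}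
    (hn : 0 < n) (hdn : d ≤ 2 * n) {Pr : Measure Ω} [IsProbabilityMeasure Pr]
    {D : Fin n → Ω → X × Bool} (hD : ∀ i, HasLaw (D i) (sampleLaw μ g) Pr)
    (hDi : iIndepFun D Pr) :
    ∃ B : Set Ω, MeasurableSet B ∧ Pr B ≤ ENNReal.ofReal (δ / 2) ∧ ∀ ω ∉ B, ∀ h ∈ H,
      risk μ (h ∘ φ) g ≤ empiricalRisk (h ∘ φ) (fun i => D i ω) + complexityTerm n d δ := by
  have hprob := isProbabilityMeasure_sampleLaw μ hg
  have hn' : (0 : ℝ) < n := by exact_mod_cast hn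
  have hmapφ : (sampleLaw μ g).map (fun w => φ w.1) = μ.map φ := by
    conv_rhs => rw [← map_fst_sampleLaw μ hg]
    exact (Measure.map_map hφ measurable_fst).symm
  have hdev := measure_exists_deviation_le (H := H) (ψ := fun w : X × Bool => φ w.1)
    (y := Prod.snd) (n := n) (sampleLaw μ g) (hφ.comp measurable_fst) measurable_snd hHm
    (by rwa [hmapφ]) hd (ε := complexityTerm n d δ) (Real.sqrt_nonneg _)
  replace hdev := hdev.trans (ENNReal.ofReal_le_ofReal
    (sum_choose_mul_exp_complexityTerm_le hn hdn hδ hδ1))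
  set A : Set (Fin n → X × Bool) := {s | ∃ h ∈ H, n * complexityTerm n d δ <
    n * (∫ w, zeroOneLoss (h (φ w.1)) w.2 ∂(sampleLaw μ g)) -
      ∑ i, zeroOneLoss (h (φ (s i).1)) (s i).2} with hA
  have hDm : ∀ i, AEMeasurable (D i) Pr := fun i => (hD i).aemeasurable
  have hDm' : AEMeasurable (fun ω i => D i ω) Pr := aemeasurable_pi_lambda _ hDm
  have hlaw : Pr.map (fun ω i => D i ω) = Measure.pi fun _ : Fin n => sampleLaw μ g := by
    rw [(iIndepFun_iff_map_fun_eq_pi_map hDm).1 hDi]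
    simp_rw [fun i => (hD i).map_eq]
  -- Only the outer measure of the bad set is controlled. Measurable hulls, on `Ω` and again on the
  -- sample space, yield an actual event of the same bound.
  refine ⟨toMeasurable Pr ((fun ω i => D i ω) ⁻¹' A), measurableSet_toMeasurable _ _, ?_, ?_⟩
  · rw [measure_toMeasurable]
    refine (measure_mono (Set.preimage_mono (subset_toMeasurable
      (Measure.pi fun _ : Fin n => sampleLaw μ g) A))).trans ?_
    rw [← Measure.map_apply_of_aemeasurable hDm' (measurableSet_toMeasurable _ _), hlaw,
      measure_toMeasurable]
    exact hdev
  · intro ω hω h hh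
    have hω' : (fun i => D i ω) ∉ A := fun hmem => hω (subset_toMeasurable _ _ hmem)
    rw [hA, Set.mem_ofPred_eq] at hω'
    push Not at hω'
    have h1 := hω' h hh
    have h2 : ∫ w, zeroOneLoss (h (φ w.1)) w.2 ∂(sampleLaw μ g) = risk μ (h ∘ φ) g :=
      integral_zeroOneLoss_sampleLaw μ hg ((hHm h hh).comp hφ)
    rw [h2] at h1
    have h3 : empiricalRisk (h ∘ φ) (fun i => D i ω) =
        (∑ i, zeroOneLoss (h (φ (D i ω).1)) (D i ω).2) / n := by
      simp [empiricalRisk, div_eq_inv_mul]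
    rw [h3]
    have h4 : risk μ (h ∘ φ) g - complexityTerm n d δ ≤
        (∑ i, zeroOneLoss (h (φ (D i ω).1)) (D i ω).2) / n := by
      rw [le_div_iff₀ hn']
      linarith
    linarith

end SampleLaw

/-! ### Transfer between the domains on the latent space -/

section Latent

theorem labelLoss_mem_Icc (a : Bool) (p : I) : labelLoss a p ∈ Set.Icc (0 : ℝ) 1 := by
  have h0 : (0 : ℝ) ≤ p := p.2.1
  have h1 : (p : ℝ) ≤ 1 := p.2.2
  cases a <;> simp [labelLoss, zeroOneLoss, h0, h1]

theorem labelLoss_sub_le_abs (a : Bool) (p q : I) :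
    labelLoss a p - labelLoss a q ≤ |(p : ℝ) - q| := by
  cases a
  · simpa [labelLoss, zeroOneLoss] using le_abs_self ((p : ℝ) - q)
  · simpa [labelLoss, zeroOneLoss] using neg_le_abs ((p : ℝ) - q)

theorem measurable_labelLoss {X : Type*} [MeasurableSpace X] {f : X → Bool} (hf : Measurable f)
    {g : X → I} (hg : Measurable g) : Measurable fun x => labelLoss (f x) (g x) := by
  have hgm : Measurable fun x => (g x : ℝ) := measurable_subtype_coe.comp hg
  exact (hgm.mul (measurable_zeroOneLoss hf measurable_const)).add
    ((hgm.const_sub 1).mul (measurable_zeroOneLoss hf measurable_const))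

/-- This brings the risk to integrals of the labeling function over the sets where the prediction is
constant, the form in which the conditional-mean property of `IsInducedLabeling` applies. -/
theorem risk_eq_setIntegral {X : Type*} [MeasurableSpace X] (μ : Measure X)
    [IsProbabilityMeasure μ] {f : X → Bool} (hf : Measurable f) {g : X → I} (hg : Measurable g) :
    risk μ f g = ∫ x in f ⁻¹' {false}, (g x : ℝ) ∂μ +
      (μ.real (f ⁻¹' {false})ᶜ - ∫ x in (f ⁻¹' {false})ᶜ, (g x : ℝ) ∂μ) := by
  have hB : MeasurableSet (f ⁻¹' {false}) := hf (measurableSet_singleton _)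
  have hgi : Integrable (fun x => (g x : ℝ)) μ :=
    Integrable.of_mem_Icc 0 1 (measurable_subtype_coe.comp hg).aemeasurable
      (ae_of_all _ fun x => (g x).2)
  have hi : Integrable (fun x => labelLoss (f x) (g x)) μ :=
    Integrable.of_mem_Icc 0 1 (measurable_labelLoss hf hg).aemeasurable
      (ae_of_all _ fun x => labelLoss_mem_Icc _ _)
  rw [risk, ← integral_add_compl hB hi]
  congr 1
  · refine setIntegral_congr_fun hB fun x hx => ?_
    have hx' : f x = false := hx
    simp [labelLoss, zeroOneLoss, hx']
  · have h1 : ∫ x in (f ⁻¹' {false})ᶜ, labelLoss (f x) (g x) ∂μ =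
        ∫ x in (f ⁻¹' {false})ᶜ, (1 - (g x : ℝ)) ∂μ := by
      refine setIntegral_congr_fun hB.compl fun x hx => ?_
      have hx' : f x = true := by simpa using hx
      simp [labelLoss, zeroOneLoss, hx']
    rw [h1, integral_sub (integrable_const _) hgi.integrableOn]
    simp

/-- The risk of a classifier that factors through the features is its latent risk. -/
theorem risk_comp_eq_risk_map {X Z : Type*} [MeasurableSpace X] [MeasurableSpace Z]
    (μ : Measure X) [IsProbabilityMeasure μ] {φ : X → Z} (hφ : Measurable φ) {g : X → I}
    (hg : Measurable g) {g' : Z → I} (hg' : IsInducedLabeling μ φ g g') {h : Z → Bool}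
    (hh : Measurable h) : risk μ (h ∘ φ) g = risk (μ.map φ) h g' := by
  have : IsProbabilityMeasure (μ.map φ) := Measure.isProbabilityMeasure_map hφ.aemeasurable
  have hB : MeasurableSet (h ⁻¹' {false}) := hh (measurableSet_singleton _)
  rw [risk_eq_setIntegral μ (hh.comp hφ) hg, risk_eq_setIntegral (μ.map φ) hh hg'.measurable,
    ← hg'.setIntegral_eq _ hB, ← hg'.setIntegral_eq _ hB.compl,
    map_measureReal_apply hφ hB.compl]
  rfl

variable {Z : Type*} [MeasurableSpace Z] (μ ν : Measure Z) [IsProbabilityMeasure μ]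
  [IsProbabilityMeasure ν] {f : Z → Bool} {p q : Z → I}

theorem risk_le_risk_add_integral_abs (hf : Measurable f) (hp : Measurable p) (hq : Measurable q) :
    risk μ f p ≤ risk μ f q + ∫ z, |(p z : ℝ) - q z| ∂μ := by
  have hi : ∀ r : Z → I, Measurable r → Integrable (fun z => labelLoss (f z) (r z)) μ :=
    fun r hr => Integrable.of_mem_Icc 0 1 (measurable_labelLoss hf hr).aemeasurable
      (ae_of_all _ fun z => labelLoss_mem_Icc _ _)
  have hri : ∀ r : Z → I, Measurable r → Integrable (fun z => (r z : ℝ)) μ :=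
    fun r hr => Integrable.of_mem_Icc 0 1 (measurable_subtype_coe.comp hr).aemeasurable
      (ae_of_all _ fun z => (r z).2)
  have habs : Integrable (fun z => |(p z : ℝ) - q z|) μ := ((hri p hp).sub (hri q hq)).abs
  rw [risk, risk, ← integral_add (hi q hq) habs]
  refine integral_mono (hi p hp) ((hi q hq).add habs) fun z => ?_
  change _ ≤ labelLoss (f z) (q z) + |(p z : ℝ) - q z|
  linarith [labelLoss_sub_le_abs (f z) (p z) (q z)]

theorem risk_le_risk_add_sqrt_klDiv (hf : Measurable f) (hp : Measurable p) (h : klDiv μ ν ≠ ∞) :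
    risk ν f p ≤ risk μ f p + √(2 * (klDiv μ ν).toReal) / 2 := by
  have h1 := two_mul_sq_integral_sub_le_klDiv μ ν (measurable_labelLoss hf hp)
    (fun z => labelLoss_mem_Icc _ _) h
  have h2 : 2 * (risk ν f p - risk μ f p) ≤ √(2 * (klDiv μ ν).toReal) := by
    refine Real.le_sqrt_of_sq_le ?_
    unfold risk
    nlinarith
  linarith

/-- Transfer of the risk between two domains with different features and labeling functions. -/
theorem risk_le_risk_add_min_add_sqrt_klDiv (hf : Measurable f) (hp : Measurable p)
    (hq : Measurable q) (h : klDiv μ ν ≠ ∞) :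
    risk ν f p ≤ risk μ f q + min (∫ z, |(p z : ℝ) - q z| ∂μ) (∫ z, |(p z : ℝ) - q z| ∂ν) +
      √(2 * (klDiv μ ν).toReal) / 2 := by
  rw [← min_add_add_left, ← min_add_add_right, le_min_iff]
  -- The labeling function is changed under `μ` for the first entry of the minimum and under `ν` for
  -- the second.
  constructor
  · linarith [risk_le_risk_add_sqrt_klDiv μ ν hf hp h, risk_le_risk_add_integral_abs μ hf hp hq]
  · linarith [risk_le_risk_add_sqrt_klDiv μ ν hf hq h, risk_le_risk_add_integral_abs ν hf hp hq]

end Latent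

end UnbiasedRec

/-! ### Assembly of the generalization bound -/

theorem theorem4
    {XU XI Z Ω : Type*} [MeasurableSpace XU] [MeasurableSpace XI] [MeasurableSpace Z]
    [MeasurableSpace Ω]
    -- training and testing feature laws, with their labeling functions
    (P Q : Measure (XU × XI)) [IsProbabilityMeasure P] [IsProbabilityMeasure Q]
    (k g : XU × XI → I) (hk : Measurable k) (hg : Measurable g)
    -- feature map and induced latent labeling functions
    (φ : XU × XI → Z) (hφ : Measurable φ)
    (k' g' : Z → I)
    (hk' : UnbiasedRec.IsInducedLabeling P φ k k')
    (hg' : UnbiasedRec.IsInducedLabeling Q φ g g')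
    -- hypothesis class of VC-dimension `d`
    (H : Set (Z → Bool)) (d : ℕ) (hd : UnbiasedRec.vcDim H = d)
    (hH : ∀ h ∈ H, Measurable h)
    (hHP : UnbiasedRec.HasMeasurableTraces H (P.map φ))
    (hHQ : UnbiasedRec.HasMeasurableTraces H (Q.map φ))
    -- parameters
    (ρ : ℝ) (hρ : ρ ∈ Set.Icc (0 : ℝ) 1) (δ : ℝ) (hδ : 0 < δ)
    (N M : ℕ) (hN : 0 < ρ → 0 < N ∧ d ≤ 2 * N) (hM : ρ < 1 → 0 < M ∧ d ≤ 2 * M)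
    -- i.i.d. biased sample of size `N` and i.i.d. unbiased sample of size `M`
    (Pr : Measure Ω) [IsProbabilityMeasure Pr]
    (DP : Fin N → Ω → (XU × XI) × Bool) (DQ : Fin M → Ω → (XU × XI) × Bool)
    (hDP : ∀ i, HasLaw (DP i) (UnbiasedRec.sampleLaw P k) Pr) (hDPi : iIndepFun DP Pr)
    (hDQ : ∀ i, HasLaw (DQ i) (UnbiasedRec.sampleLaw Q g) Pr) (hDQi : iIndepFun DQ Pr) :
    ∃ E : Set Ω, MeasurableSet E ∧ ENNReal.ofReal (1 - δ) ≤ Pr E ∧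
      ∀ ω ∈ E, ∀ h ∈ H,
        ENNReal.ofReal (UnbiasedRec.risk Q (h ∘ φ) g) ≤
          ENNReal.ofReal
            (ρ * UnbiasedRec.empiricalRisk (h ∘ φ) (fun i => DP i ω) +
              (1 - ρ) * UnbiasedRec.empiricalRisk (h ∘ φ) (fun i => DQ i ω) +
              ρ * min (∫ z, |(g' z : ℝ) - k' z| ∂(P.map φ)) (∫ z, |(g' z : ℝ) - k' z| ∂(Q.map φ)) +
              (1 - ρ) * UnbiasedRec.complexityTerm M d δ +
              ρ * UnbiasedRec.complexityTerm N d δ) +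
          ENNReal.ofReal (ρ / 2) * (2 * klDiv (P.map φ) (Q.map φ)) ^ (1 / 2 : ℝ) := by
  -- For `δ > 1` the required probability is `0` and the empty event serves. Otherwise `log (4 / δ)`
  -- is nonnegative, as the VC bound needs.
  rcases lt_or_ge 1 δ with hδ1 | hδ1
  · exact ⟨∅, MeasurableSet.empty, by simp [ENNReal.ofReal_of_nonpos (sub_nonpos.2 hδ1.le)],
      fun ω hω => hω.elim⟩
  -- Carrying the factor `ρ` makes the claim trivial for `ρ = 0`, where the training sample may be
  -- empty.
  have hevP : ∃ B : Set Ω, MeasurableSet B ∧ Pr B ≤ ENNReal.ofReal (δ / 2) ∧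
      ∀ ω ∉ B, ∀ h ∈ H, ρ * UnbiasedRec.risk P (h ∘ φ) k ≤
        ρ * (UnbiasedRec.empiricalRisk (h ∘ φ) (fun i => DP i ω) +
          UnbiasedRec.complexityTerm N d δ) := by
    rcases hρ.1.eq_or_lt with rfl | hρ0
    · exact ⟨∅, MeasurableSet.empty, by simp, by simp⟩
    · obtain ⟨B, hB, hPB, hr⟩ := UnbiasedRec.exists_event_risk_le P hk hφ hd hH hHP hδ hδ1
        (hN hρ0).1 (hN hρ0).2 hDP hDPi
      exact ⟨B, hB, hPB, fun ω hω h hh => mul_le_mul_of_nonneg_left (hr ω hω h hh) hρ.1⟩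
  have hevQ : ∃ B : Set Ω, MeasurableSet B ∧ Pr B ≤ ENNReal.ofReal (δ / 2) ∧
      ∀ ω ∉ B, ∀ h ∈ H, (1 - ρ) * UnbiasedRec.risk Q (h ∘ φ) g ≤
        (1 - ρ) * (UnbiasedRec.empiricalRisk (h ∘ φ) (fun i => DQ i ω) +
          UnbiasedRec.complexityTerm M d δ) := by
    rcases hρ.2.eq_or_lt with rfl | hρ1
    · exact ⟨∅, MeasurableSet.empty, by simp, by simp⟩
    · obtain ⟨B, hB, hPB, hr⟩ := UnbiasedRec.exists_event_risk_le Q hg hφ hd hH hHQ hδ hδ1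
        (hM hρ1).1 (hM hρ1).2 hDQ hDQi
      exact ⟨B, hB, hPB,
        fun ω hω h hh => mul_le_mul_of_nonneg_left (hr ω hω h hh) (sub_nonneg.2 hρ.2)⟩
  obtain ⟨A, hA, hPA, hrA⟩ := hevP
  obtain ⟨B, hB, hPB, hrB⟩ := hevQ
  refine ⟨(A ∪ B)ᶜ, (hA.union hB).compl, ?_, fun ω hω h hh => ?_⟩
  -- A union bound over the two exceptional events, each of measure at most `δ / 2`. The two samples
  -- may depend on each other.
  · rw [prob_compl_eq_one_sub (hA.union hB), ENNReal.ofReal_sub _ hδ.le, ENNReal.ofReal_one]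
    refine tsub_le_tsub_left ((measure_union_le A B).trans ((add_le_add hPA hPB).trans ?_)) 1
    rw [← ENNReal.ofReal_add (by positivity) (by positivity), add_halves]
  · have hωA : ω ∉ A := fun hmem => hω (Or.inl hmem)
    have hωB : ω ∉ B := fun hmem => hω (Or.inr hmem)
    have hPz : IsProbabilityMeasure (P.map φ) := Measure.isProbabilityMeasure_map hφ.aemeasurable
    have hQz : IsProbabilityMeasure (Q.map φ) := Measure.isProbabilityMeasure_map hφ.aemeasurable
    have h1 := hrA ω hωA h hh
    have h2 := hrB ω hωB h hh
    -- For `ρ = 0` the testing sample alone gives the bound, even if the divergence is infinite. For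
    -- `ρ > 0` an infinite divergence makes the right side `∞`.
    rcases hρ.1.eq_or_lt with rfl | hρ0
    · refine le_add_right (ENNReal.ofReal_le_ofReal ?_)
      linarith
    · by_cases hkl : klDiv (P.map φ) (Q.map φ) = ∞
      · have hρ2 : 0 < ρ / 2 := by positivity
        rw [hkl, ENNReal.mul_top two_ne_zero, ENNReal.top_rpow_of_pos (by norm_num),
          ENNReal.mul_top (ENNReal.ofReal_pos.2 hρ2).ne', add_top]
        exact le_top
      · have h3 := UnbiasedRec.risk_le_risk_add_min_add_sqrt_klDiv (P.map φ) (Q.map φ) (hH h hh)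
          hg'.measurable hk'.measurable hkl
        rw [← UnbiasedRec.risk_comp_eq_risk_map Q hφ hg hg' (hH h hh),
          ← UnbiasedRec.risk_comp_eq_risk_map P hφ hk hk' (hH h hh)] at h3
        have h4 : (2 * klDiv (P.map φ) (Q.map φ)) ^ (1 / 2 : ℝ) =
            ENNReal.ofReal √(2 * (klDiv (P.map φ) (Q.map φ)).toReal) := by
          rw [Real.sqrt_eq_rpow, ← ENNReal.ofReal_rpow_of_nonneg (by positivity) (by norm_num),
            ENNReal.ofReal_mul two_pos.le, ENNReal.ofReal_toReal hkl, ENNReal.ofReal_ofNat]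
        rw [h4, ← ENNReal.ofReal_mul (by positivity)]
        refine (ENNReal.ofReal_le_ofReal ?_).trans ENNReal.ofReal_add_le
        -- Only the share `ρ` of the testing risk is transferred to the training domain; `h1` then
        -- bounds the training risk, and `h2` the remaining share.
        have h5 := mul_le_mul_of_nonneg_left h3 hρ.1
        linarith
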